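/- Let $a,c\in\mathbb{Z}$ and $f(X)=X^5+aX^3+cX$. Assume that $a<0$ and that, whenever $a=4^k b$ with $k\ge 0$ and $b\in\mathbb{Z}$, one has $-b\not\equiv 2,18,34\pmod{48}$ (if $4\nmid a$ this just says $-a\not\equiv 2,18,34\pmod{48}$). Then the equation $$f(p)+f(q)=f(r)+f(s)$$ has a non-trivial two-parametric rational solution: there are rational functions $p,q,r,s\in\mathbb{Q}(u,v)$ in two independent variables $u,v$ such that 1. $f(p)+f(q)=f(r)+f(s)$ holds identically in $\mathbb{Q}(u,v)$; 2. the solution is non-trivial, i.e. $\{p,q\}\cap\{r,s\}=\emptyset$, $\{f(p),f(q)\}\cap\{f(r),f(s)\}=\emptyset$, and $f(p)+f(q)\neq 0$ (in particular it is not one of the obvious solutions with $q=-p$, $s=-r$) as elements of $\mathbb{Q}(u,v)$; 3. $\mathbb{Q}(p,q,r,s)=\mathbb{Q}(u,v)$, so $(u,v)\mapsto(p,q,r,s)$ is birational onto its image, a $\mathbb{Q}$-rational surface contained in the hypersurface $f(p)+f(q)=f(r)+f(s)$. -/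

import Mathlib

open Polynomial

/-- The quintic polynomial `X ^ 5 + a X ^ 3 + c X` with integer coefficients. -/
noncomputable def oddQuintic (a c : ℤ) : ℤ[X] := X ^ 5 + C a * X ^ 3 + C c * X

/-- The field `ℚ(u, v)` of rational functions in two independent parameters. -/
abbrev TwoParamField : Type := FractionRing (MvPolynomial (Fin 2) ℚ)

/-- `(p, q, r, s)` lies on the hypersurface `f(p) + f(q) = f(r) + f(s)`. -/
def OnHypersurface {K : Type*} [Field K] (f : ℤ[X]) (p q r s : K) : Prop :=
  aeval p f + aeval q f = aeval r f + aeval s f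

/-- Non-triviality of a point for an odd polynomial `f`: `{p, q}` and `{r, s}` are disjoint,
`{f(p), f(q)}` and `{f(r), f(s)}` are disjoint, and the common value `f(p) + f(q)` is nonzero.
The last condition excludes the solutions `q = -p`, `s = -r`, which exist because `f` is odd. -/
def NonTrivialPoint {K : Type*} [Field K] (f : ℤ[X]) (p q r s : K) : Prop :=
  Disjoint ({p, q} : Set K) {r, s} ∧
  Disjoint ({aeval p f, aeval q f} : Set K) {aeval r f, aeval s f} ∧
  aeval p f + aeval q f ≠ 0

/-- Four rational functions `p, q, r, s ∈ ℚ(u, v)` form a two-parametric rational solution of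
`f(p) + f(q) = f(r) + f(s)`: the equation holds identically, the solution is non-trivial, and
`ℚ(p, q, r, s) = ℚ(u, v)`, that is, `(u, v) ↦ (p, q, r, s)` is birational onto its image, so that
both parameters are essential and the image is a `ℚ`-rational surface. -/
structure IsTwoParametricSolution (f : ℤ[X]) (p q r s : TwoParamField) : Prop where
  onHypersurface : OnHypersurface f p q r s
  nonTrivial : NonTrivialPoint f p q r s
  birational : IntermediateField.adjoin ℚ ({p, q, r, s} : Set TwoParamField) = ⊤

/-!
For `s = p + q - r` the difference `f(p) + f(q) - f(r) - f(s)` is divisible by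
`5 (p ^ 2 + q ^ 2 + r ^ 2 + s ^ 2) + 6 a`, with a quotient that does not involve `c`. Putting
`p, q = t ± x` and `r, s = t ± y` turns the vanishing of this form into the quadric
`2 t ^ 2 + x ^ 2 + y ^ 2 = -3 a / 5`. The form on the left represents every positive rational
`n / m` for which `n m` is not of the shape `4 ^ k (16 j + 14)`: as in Dirichlet's treatment of
sums of three squares, an auxiliary prime in an arithmetic progression reduces this to
Legendre's theorem on ternary forms, which follows from a pigeonhole argument. Stereographic
projection from a rational point then parametrises the quadric by `(u, v)`. Non-triviality is a
matter of transcendence degree: each excluded coincidence makes one of `p, q` and one of `r, s`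
(or `p` and `q`) algebraically dependent, and on the quadric this makes all of `ℚ(u, v)` algebraic
over the field generated by a single element.
-/

theorem exists_ne_zero_map_eq_zero_of_card_lt {ι G : Type*} [Fintype ι] [AddGroup G] [Finite G]
    (φ : (ι → ℤ) →+ G) {N : ι → ℕ} (h : Nat.card G < ∏ i, (N i + 1)) :
    ∃ v ≠ 0, φ v = 0 ∧ ∀ i, |v i| ≤ N i := by
  classical
  have := Fintype.ofFinite G
  let box : Finset (ι → ℤ) := Finset.Icc 0 fun i => (N i : ℤ)
  have hbox : (Finset.univ : Finset G).card < box.card := by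
    have hcard : box.card = ∏ i, (N i + 1) := by simp [box, Pi.card_Icc]
    rwa [Finset.card_univ, hcard, ← Nat.card_eq_fintype_card]
  obtain ⟨v, hv, w, hw, hne, heq⟩ :=
    Finset.exists_ne_map_eq_of_card_lt_of_maps_to hbox (f := φ) fun _ _ => Finset.mem_univ _
  simp only [box, Finset.mem_Icc, Pi.le_def, Pi.zero_apply] at hv hw
  refine ⟨v - w, sub_ne_zero.mpr hne, by rw [map_sub, heq, sub_self], fun i => ?_⟩
  exact abs_sub_le_of_nonneg_of_le (hv.1 i) (hv.2 i) (hw.1 i) (hw.2 i)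

theorem exists_small_solution_of_congruences {a b c : ℕ} (ha : 0 < a) (hb : 0 < b) (hc : 0 < c)
    (α β γ : ℤ) :
    ∃ x y z : ℤ, ¬(x = 0 ∧ y = 0 ∧ z = 0) ∧
      (a : ℤ) ∣ y - α * z ∧ (b : ℤ) ∣ x - β * z ∧ (c : ℤ) ∣ y - γ * x ∧
      x ^ 2 ≤ b * c ∧ y ^ 2 ≤ a * c ∧ z ^ 2 ≤ a * b := by
  have : NeZero a := ⟨ha.ne'⟩
  have : NeZero b := ⟨hb.ne'⟩
  have : NeZero c := ⟨hc.ne'⟩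
  let φ : (Fin 3 → ℤ) →+ ZMod a × ZMod b × ZMod c :=
    { toFun := fun v => ((v 1 - α * v 2 : ℤ), (v 0 - β * v 2 : ℤ), (v 1 - γ * v 0 : ℤ))
      map_zero' := by simp
      map_add' := fun v w => by
        ext <;> push_cast [Pi.add_apply, Prod.fst_add, Prod.snd_add] <;> ring }
  have hcard : Nat.card (ZMod a × ZMod b × ZMod c) <
      ∏ i, (![(b * c).sqrt, (a * c).sqrt, (a * b).sqrt] i + 1) := by
    simp only [Nat.card_prod, Nat.card_zmod, Fin.prod_univ_three, Matrix.cons_val]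
    refine Nat.mul_self_lt_mul_self_iff.mp ?_
    calc a * (b * c) * (a * (b * c)) = b * c * (a * c) * (a * b) := by ring
      _ < ((b * c).sqrt + 1) * ((b * c).sqrt + 1) * (((a * c).sqrt + 1) * ((a * c).sqrt + 1)) *
          (((a * b).sqrt + 1) * ((a * b).sqrt + 1)) :=
        Nat.mul_lt_mul'' (Nat.mul_lt_mul'' (Nat.lt_succ_sqrt _) (Nat.lt_succ_sqrt _))
          (Nat.lt_succ_sqrt _)
      _ = _ := by ring
  obtain ⟨v, hv, hφ, hle⟩ := exists_ne_zero_map_eq_zero_of_card_lt φ hcard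
  have hsq {x : ℤ} {n : ℕ} (hx : |x| ≤ n.sqrt) : x ^ 2 ≤ n := by
    rw [← sq_abs]
    exact (pow_le_pow_left₀ (abs_nonneg x) hx 2).trans (mod_cast n.sqrt_le')
  simp only [φ, AddMonoidHom.coe_mk, ZeroHom.coe_mk, Prod.mk_eq_zero,
    ZMod.intCast_zmod_eq_zero_iff_dvd] at hφ
  refine ⟨v 0, v 1, v 2, fun h => hv ?_, hφ.1, hφ.2.1, hφ.2.2, ?_, ?_, ?_⟩
  · ext i
    fin_cases i
    exacts [h.1, h.2.1, h.2.2]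
  · exact_mod_cast hsq (hle 0)
  · exact_mod_cast hsq (hle 1)
  · exact_mod_cast hsq (hle 2)

theorem dvd_mul_sq_add_mul_sq {R : Type*} [CommRing R] {n u v t x y : R}
    (h : n ∣ u + v * t ^ 2) (hxy : n ∣ y - t * x) : n ∣ u * x ^ 2 + v * y ^ 2 := by
  have heq : u * x ^ 2 + v * y ^ 2 =
      (u + v * t ^ 2) * x ^ 2 + (y - t * x) * (v * (y + t * x)) := by ring
  rw [heq]
  exact dvd_add (h.mul_right _) (hxy.mul_right _)

section Legendre

variable {a b c : ℕ} {α β γ : ℤ}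

theorem exists_small_legendre_value (ha : 0 < a) (hb : 0 < b) (hc : 0 < c)
    (hab : a.Coprime b) (hac : a.Coprime c) (hbc : b.Coprime c)
    (hα : (a : ℤ) ∣ c - b * α ^ 2) (hβ : (b : ℤ) ∣ c - a * β ^ 2) (hγ : (c : ℤ) ∣ a + b * γ ^ 2) :
    ∃ x y z : ℤ, ¬(x = 0 ∧ y = 0 ∧ z = 0) ∧
      (a * b * c : ℤ) ∣ a * x ^ 2 + b * y ^ 2 - c * z ^ 2 ∧
      x ^ 2 ≤ b * c ∧ y ^ 2 ≤ a * c ∧ z ^ 2 ≤ a * b := by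
  obtain ⟨x, y, z, hne, hda, hdb, hdc, hx, hy, hz⟩ :=
    exists_small_solution_of_congruences ha hb hc α β γ
  refine ⟨x, y, z, hne, ?_, hx, hy, hz⟩
  have hab' : IsCoprime (a : ℤ) b := Nat.isCoprime_iff_coprime.mpr hab
  have hac' : IsCoprime (a : ℤ) c := Nat.isCoprime_iff_coprime.mpr hac
  have hbc' : IsCoprime (b : ℤ) c := Nat.isCoprime_iff_coprime.mpr hbc
  refine (hac'.mul_left hbc').mul_dvd (hab'.mul_dvd ?_ ?_) ?_
  · have := dvd_mul_sq_add_mul_sq (v := -(b : ℤ)) (by simpa [sub_eq_add_neg] using hα) hda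
    convert (dvd_mul_right (a : ℤ) (x ^ 2)).sub this using 1
    ring
  · have := dvd_mul_sq_add_mul_sq (v := -(a : ℤ)) (by simpa [sub_eq_add_neg] using hβ) hdb
    convert (dvd_mul_right (b : ℤ) (y ^ 2)).sub this using 1
    ring
  · exact (dvd_mul_sq_add_mul_sq hγ hdc).sub (dvd_mul_right _ _)

theorem exists_legendre_solution_of_not_isSquare (ha : 0 < a) (hb : 0 < b) (hc : 0 < c)
    (hab : a.Coprime b) (hac : a.Coprime c) (hbc : b.Coprime c) (hsq : ¬IsSquare (a * b))
    (hα : (a : ℤ) ∣ c - b * α ^ 2) (hβ : (b : ℤ) ∣ c - a * β ^ 2) (hγ : (c : ℤ) ∣ a + b * γ ^ 2) :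
    ∃ x y z : ℤ, z ≠ 0 ∧ a * x ^ 2 + b * y ^ 2 = c * z ^ 2 := by
  obtain ⟨x, y, z, hne, ⟨k, hk⟩, hx, hy, hz⟩ :=
    exists_small_legendre_value ha hb hc hab hac hbc hα hβ hγ
  have hsq' (w : ℤ) : w ^ 2 ≠ a * b := fun hw =>
    hsq (Int.isSquare_natCast_iff.mp ⟨w, by rw [Nat.cast_mul, ← hw, sq]⟩)
  zify at ha hb hc
  have hx_le : a * x ^ 2 ≤ a * (b * c : ℤ) := by gcongr
  have hy_le : b * y ^ 2 ≤ b * (a * c : ℤ) := by gcongr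
  have hz_le : c * z ^ 2 ≤ c * (a * b : ℤ) := by gcongr
  have hx_nonneg : 0 ≤ a * x ^ 2 := by positivity
  have hy_nonneg : 0 ≤ b * y ^ 2 := by positivity
  have hz_nonneg : 0 ≤ c * z ^ 2 := by positivity
  have hk_lt : k < 2 := by
    by_contra! h
    have hmul : (a * b * c : ℤ) * 2 ≤ a * b * c * k := by gcongr
    have hx_eq : x ^ 2 = b * c := mul_left_cancel₀ ha.ne' (by linarith)
    have hy_eq : y ^ 2 = a * c := mul_left_cancel₀ hb.ne' (by linarith)
    have hxy : (x * y) ^ 2 = c ^ 2 * (a * b : ℤ) := by rw [mul_pow, hx_eq, hy_eq]; ring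
    obtain ⟨w, hw⟩ : (c : ℤ) ∣ x * y := (Int.pow_dvd_pow_iff two_ne_zero).mp ⟨_, hxy⟩
    rw [hw, mul_pow] at hxy
    exact hsq' w (mul_left_cancel₀ (by positivity) hxy)
  have hk_gt : -1 < k := by
    by_contra! h
    have hmul : (a * b * c : ℤ) * k ≤ a * b * c * -1 := by gcongr
    exact hsq' z (mul_left_cancel₀ hc.ne' (by linarith))
  obtain rfl | rfl : k = 0 ∨ k = 1 := by omega
  · refine ⟨x, y, z, ?_, by linarith⟩
    rintro rfl
    have hx0 : x ^ 2 = 0 := (mul_eq_zero_iff_left ha.ne').mp (by linarith)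
    have hy0 : y ^ 2 = 0 := (mul_eq_zero_iff_left hb.ne').mp (by linarith)
    exact hne ⟨by simpa using hx0, by simpa using hy0, rfl⟩
  · -- The form `z² + a b w²` is multiplicative, and `c (z² + a b) = a x² + b y²`.
    refine ⟨x * z - b * y, y * z + a * x, z ^ 2 + a * b, by positivity, ?_⟩
    linear_combination (z ^ 2 + a * b : ℤ) * hk

theorem exists_legendre_solution_of_isSquare (ha : 0 < a) (hb : 0 < b) (hab : a.Coprime b)
    (hac : a.Coprime c) (hsq : IsSquare (a * b)) (hγ : (c : ℤ) ∣ a + b * γ ^ 2) :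
    ∃ x y z : ℤ, z ≠ 0 ∧ a * x ^ 2 + b * y ^ 2 = c * z ^ 2 := by
  obtain ⟨r, hr⟩ := hsq
  obtain ⟨s, rfl⟩ := exists_eq_pow_of_mul_eq_pow (Nat.isUnit_iff.mpr hab) (hr.trans (sq r).symm)
  obtain ⟨t, rfl⟩ := exists_eq_pow_of_mul_eq_pow (Nat.isUnit_iff.mpr hab.symm)
    ((mul_comm b _).trans (hr.trans (sq r).symm))
  have hs : (s : ZMod c) * (s : ZMod c)⁻¹ = 1 :=
    ZMod.coe_mul_inv_eq_one s (Nat.Coprime.coprime_dvd_left (dvd_pow_self s two_ne_zero) hac)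
  have hγ' : (s : ZMod c) ^ 2 + t ^ 2 * γ ^ 2 = 0 := by
    exact_mod_cast (ZMod.intCast_zmod_eq_zero_iff_dvd _ c).mpr hγ
  have hneg : IsSquare (-1 : ZMod c) := by
    refine ⟨t * γ * (s : ZMod c)⁻¹, ?_⟩
    linear_combination -(s : ZMod c)⁻¹ ^ 2 * hγ' + (s * (s : ZMod c)⁻¹ + 1) * hs
  obtain ⟨g, h, rfl⟩ := Nat.eq_sq_add_sq_of_isSquare_mod_neg_one hneg
  refine ⟨t * g, s * h, s * t, ?_, by push_cast; ring⟩
  have hs0 : s ≠ 0 := by rintro rfl; simp at ha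
  have ht0 : t ≠ 0 := by rintro rfl; simp at hb
  exact_mod_cast mul_ne_zero hs0 ht0

theorem exists_legendre_solution (ha : 0 < a) (hb : 0 < b) (hc : 0 < c)
    (hab : a.Coprime b) (hac : a.Coprime c) (hbc : b.Coprime c)
    (hα : (a : ℤ) ∣ c - b * α ^ 2) (hβ : (b : ℤ) ∣ c - a * β ^ 2) (hγ : (c : ℤ) ∣ a + b * γ ^ 2) :
    ∃ x y z : ℤ, z ≠ 0 ∧ a * x ^ 2 + b * y ^ 2 = c * z ^ 2 := by
  by_cases hsq : IsSquare (a * b)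
  · exact exists_legendre_solution_of_isSquare ha hb hab hac hsq hγ
  · exact exists_legendre_solution_of_not_isSquare ha hb hc hab hac hbc hsq hα hβ hγ

end Legendre

theorem exists_prime_modEq_and_dvd_mul_add_one {m n d e : ℕ} [NeZero m] [NeZero n]
    (hmn : m.Coprime n) (he : e.Coprime m) (hd : d.Coprime n) :
    ∃ q : ℕ, q.Prime ∧ q ≡ e [MOD m] ∧ n ∣ d * q + 1 := by
  let crt := ZMod.chineseRemainder hmn
  let r : (ZMod m × ZMod n)ˣ := MulEquiv.prodUnits.symm
    (ZMod.unitOfCoprime e he, -(ZMod.unitOfCoprime d hd)⁻¹)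
  obtain ⟨q, -, hq, hqr⟩ :=
    Nat.forall_exists_prime_gt_and_eq_mod (r.isUnit.map crt.symm) 0
  have hcrt : ((q : ZMod m), (q : ZMod n)) = r := by
    rw [← crt.apply_symm_apply r, ← hqr, map_natCast]
    rfl
  obtain ⟨hqe, hqd⟩ := Prod.mk.inj hcrt
  refine ⟨q, hq, (ZMod.natCast_eq_natCast_iff q e m).mp hqe, ?_⟩
  have hinv : (d : ZMod n) * ↑(ZMod.unitOfCoprime d hd)⁻¹ = 1 := (ZMod.unitOfCoprime d hd).mul_inv
  rw [← ZMod.natCast_eq_zero_iff, Nat.cast_add, Nat.cast_mul, hqd]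
  simp [hinv]

theorem jacobiSym_eq_jacobiSym_neg_of_dvd_mul_add_one {n d q : ℕ} (hn : Odd n) (hq : q % 4 = 1)
    (h : n ∣ d * q + 1) : jacobiSym n q = jacobiSym (-d) n := by
  have hmod : -d * q ≡ 1 [ZMOD n] := by
    refine Int.modEq_iff_dvd.mpr ?_
    convert Int.natCast_dvd_natCast.mpr h using 1
    push_cast
    ring
  have hmul : jacobiSym (-d) n * jacobiSym q n = 1 := by
    rw [← jacobiSym.mul_left, jacobiSym.mod_left' hmod, jacobiSym.one_left]
  rw [← jacobiSym.quadratic_reciprocity_one_mod_four hq hn]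
  exact (Int.eq_of_mul_eq_one hmul).symm

theorem exists_dvd_sub_mul_sq_of_jacobiSym_eq_one {q : ℕ} [Fact q.Prime] {k n : ℤ}
    (h : jacobiSym (k * n) q = 1) : ∃ w : ℤ, (q : ℤ) ∣ n - k * w ^ 2 := by
  obtain ⟨w, hw⟩ := ZMod.isSquare_of_jacobiSym_eq_one h
  have hk : (k : ZMod q) ≠ 0 := fun hk => by
    rw [jacobiSym.mul_left, ← jacobiSym.legendreSym.to_jacobiSym q k,
      (legendreSym.eq_zero_iff q k).mpr hk, zero_mul] at h
    exact zero_ne_one h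
  obtain ⟨v, hv⟩ := ZMod.intCast_surjective (w / (k : ZMod q))
  refine ⟨v, (ZMod.intCast_zmod_eq_zero_iff_dvd _ q).mp ?_⟩
  push_cast at hw ⊢
  rw [hv]
  field_simp
  linear_combination hw

theorem exists_rat_sq_add_sq_add_mul_sq_of_dvd {n k d g h : ℕ} (hk : 0 < k) (hd : 0 < d)
    (hn : 0 < n) (hdk : d.Coprime k) (hgh : d = g ^ 2 + h ^ 2) (hkd : n ∣ k * d + 1) {α β : ℤ}
    (hα : (d : ℤ) ∣ n - k * α ^ 2) (hβ : (k : ℤ) ∣ n - d * β ^ 2) :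
    ∃ x y z : ℚ, x ^ 2 + y ^ 2 + k * z ^ 2 = n := by
  have hcop : (k * d).Coprime n :=
    Nat.Coprime.coprime_dvd_right hkd (Nat.coprime_self_add_right.mpr (Nat.coprime_one_right _))
  have hγ : (n : ℤ) ∣ d + k * (d : ℤ) ^ 2 := by
    have heq : (d + k * (d : ℤ) ^ 2) = (k * d + 1 : ℕ) * (d : ℤ) := by push_cast; ring
    rw [heq]
    exact (Int.natCast_dvd_natCast.mpr hkd).mul_right _
  obtain ⟨x, y, z, hz, hxyz⟩ := exists_legendre_solution hd hk hn hdk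
    hcop.coprime_mul_left hcop.coprime_mul_right hα hβ hγ
  have hz' : (z : ℚ) ≠ 0 := by exact_mod_cast hz
  have hxyz' : ((g : ℚ) ^ 2 + h ^ 2) * x ^ 2 + k * y ^ 2 = n * z ^ 2 := by
    rw [hgh] at hxyz
    exact_mod_cast hxyz
  refine ⟨g * x / z, h * x / z, y / z, ?_⟩
  field_simp
  linear_combination hxyz'

theorem exists_rat_sq_add_sq_add_two_mul_sq_of_odd {n : ℕ} (hn : Odd n) :
    ∃ x y z : ℚ, x ^ 2 + y ^ 2 + 2 * z ^ 2 = n := by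
  have : NeZero n := ⟨hn.pos.ne'⟩
  obtain ⟨e, he, hχ⟩ : ∃ e : ℕ, e % 4 = 1 ∧ ZMod.χ₈ e * jacobiSym (-2) n = 1 := by
    have hcop : Int.gcd (-2) n = 1 := hn.coprime_two_left
    rcases jacobiSym.eq_one_or_neg_one hcop with hJ | hJ
    · exact ⟨1, rfl, by rw [hJ]; decide⟩
    · exact ⟨5, rfl, by rw [hJ]; decide⟩
  have he2 : Odd e := Nat.odd_iff.mpr (by omega)
  obtain ⟨q, hq, hqe, hqn⟩ := exists_prime_modEq_and_dvd_mul_add_one (m := 8)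
    (hn.coprime_two_left.pow_left 3) (he2.coprime_two_right.pow_right 3) hn.coprime_two_left
  have : Fact q.Prime := ⟨hq⟩
  have hq4 : q % 4 = 1 := by unfold Nat.ModEq at hqe; omega
  have hq2 : Odd q := Nat.odd_iff.mpr (by omega)
  have hJ : jacobiSym (2 * n) q = 1 := by
    rw [jacobiSym.mul_left, jacobiSym_eq_jacobiSym_neg_of_dvd_mul_add_one hn hq4 hqn,
      jacobiSym.at_two hq2, (ZMod.natCast_eq_natCast_iff q e 8).mpr hqe]
    exact hχ
  obtain ⟨α, hα⟩ := exists_dvd_sub_mul_sq_of_jacobiSym_eq_one hJ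
  obtain ⟨g, h, hgh⟩ := Nat.Prime.sq_add_sq (p := q) (by omega)
  have hβ : ((2 : ℕ) : ℤ) ∣ n - q * 1 ^ 2 := by
    rw [one_pow, mul_one]
    exact (hn.natCast.sub_odd hq2.natCast).two_dvd
  exact exists_rat_sq_add_sq_add_mul_sq_of_dvd two_pos hq.pos hn.pos hq2.coprime_two_right
    hgh.symm hqn hα hβ

theorem exists_rat_sq_add_sq_add_sq_of_mod_four_eq_one {n : ℕ} (hn : n % 4 = 1) :
    ∃ x y z : ℚ, x ^ 2 + y ^ 2 + z ^ 2 = n := by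
  have hn2 : Odd n := Nat.odd_iff.mpr (by omega)
  have : NeZero n := ⟨hn2.pos.ne'⟩
  obtain ⟨q, hq, hq4 : q % 4 = 1, hqn⟩ := exists_prime_modEq_and_dvd_mul_add_one (m := 4) (e := 1)
    (hn2.coprime_two_left.pow_left 2) (Nat.coprime_one_left 4) (Nat.coprime_one_left n)
  have : Fact q.Prime := ⟨hq⟩
  have hJ : jacobiSym (1 * n) q = 1 := by
    rw [one_mul, jacobiSym_eq_jacobiSym_neg_of_dvd_mul_add_one hn2 hq4 hqn, Nat.cast_one,
      jacobiSym.at_neg_one hn2, ZMod.χ₄_nat_one_mod_four hn]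
  obtain ⟨α, hα⟩ := exists_dvd_sub_mul_sq_of_jacobiSym_eq_one hJ
  obtain ⟨g, h, hgh⟩ := Nat.Prime.sq_add_sq (p := q) (by omega)
  simpa using exists_rat_sq_add_sq_add_mul_sq_of_dvd one_pos hq.pos hn2.pos
    (Nat.coprime_one_right q) hgh.symm hqn hα (β := 0) (by simp)

theorem exists_rat_sq_add_sq_add_sq_of_mod_eight_eq_three {n : ℕ} (hn : n % 8 = 3) :
    ∃ x y z : ℚ, x ^ 2 + y ^ 2 + z ^ 2 = n := by
  have hn2 : Odd n := Nat.odd_iff.mpr (by omega)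
  have : NeZero n := ⟨hn2.pos.ne'⟩
  obtain ⟨q, hq, hq4 : q % 4 = 1, hqn⟩ := exists_prime_modEq_and_dvd_mul_add_one (m := 4) (e := 1)
    (hn2.coprime_two_left.pow_left 2) (Nat.coprime_one_left 4) hn2.coprime_two_left
  have : Fact q.Prime := ⟨hq⟩
  have hq2 : Odd q := Nat.odd_iff.mpr (by omega)
  have hJ : jacobiSym (1 * n) q = 1 := by
    rw [one_mul, jacobiSym_eq_jacobiSym_neg_of_dvd_mul_add_one hn2 hq4 hqn, Nat.cast_ofNat,
      jacobiSym.at_neg_two hn2, ← (ZMod.natCast_mod n 8), hn]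
    decide
  obtain ⟨α, hα⟩ := exists_dvd_sub_mul_sq_of_jacobiSym_eq_one hJ
  obtain ⟨α', hα', hαodd⟩ : ∃ α' : ℤ, (q : ℤ) ∣ n - α' ^ 2 ∧ Odd α' := by
    rw [one_mul] at hα
    rcases Int.even_or_odd α with hα2 | hα2
    · refine ⟨α + q, ?_, hα2.add_odd hq2.natCast⟩
      have heq : n - (α + q) ^ 2 = n - α ^ 2 - q * (2 * α + q) := by ring
      rw [heq]
      exact hα.sub (dvd_mul_right _ _)
    · exact ⟨α, hα, hα2⟩
  have h2qα : ((2 * q : ℕ) : ℤ) ∣ n - (1 : ℕ) * α' ^ 2 := by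
    push_cast
    rw [one_mul]
    exact (Nat.isCoprime_iff_coprime.mpr hq2.coprime_two_left).mul_dvd
      (hn2.natCast.sub_odd hαodd.pow).two_dvd hα'
  obtain ⟨g, h, hgh⟩ := Nat.Prime.sq_add_sq (p := q) (by omega)
  obtain ⟨g', h', hgh'⟩ := Nat.sq_add_sq_mul (a := 2) (x := 1) (y := 1) rfl hgh.symm
  simpa using exists_rat_sq_add_sq_add_mul_sq_of_dvd one_pos (mul_pos two_pos hq.pos) hn2.pos
    (Nat.coprime_one_right _) hgh' (by rwa [one_mul]) h2qα (β := 0) (by simp)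

theorem exists_rat_sq_add_sq_add_sq_of_odd {n : ℕ} (hn : Odd n) (hn8 : n % 8 ≠ 7) :
    ∃ x y z : ℚ, x ^ 2 + y ^ 2 + z ^ 2 = n := by
  have hn2 := Nat.odd_iff.mp hn
  rcases (by omega : n % 4 = 1 ∨ n % 8 = 3) with hn4 | hn3
  · exact exists_rat_sq_add_sq_add_sq_of_mod_four_eq_one hn4
  · exact exists_rat_sq_add_sq_add_sq_of_mod_eight_eq_three hn3

theorem exists_rat_sq_add_sq_add_two_mul_sq_of_not_four_dvd {n : ℕ} (hn4 : ¬4 ∣ n)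
    (hn16 : n % 16 ≠ 14) : ∃ x y z : ℚ, x ^ 2 + y ^ 2 + 2 * z ^ 2 = n := by
  rcases Nat.even_or_odd' n with ⟨m, rfl | rfl⟩
  · obtain ⟨x, y, z, hxyz⟩ := exists_rat_sq_add_sq_add_sq_of_odd (n := m)
      (Nat.odd_iff.mpr (by omega)) (by omega)
    refine ⟨x + y, x - y, z, ?_⟩
    push_cast
    linear_combination 2 * hxyz
  · exact exists_rat_sq_add_sq_add_two_mul_sq_of_odd (odd_two_mul_add_one m)

theorem exists_rat_sq_add_sq_add_two_mul_sq {n : ℕ}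
    (hn : ∀ k b : ℕ, n = 4 ^ k * b → b % 16 ≠ 14) :
    ∃ x y z : ℚ, x ^ 2 + y ^ 2 + 2 * z ^ 2 = n := by
  rcases eq_or_ne n 0 with rfl | hn0
  · exact ⟨0, 0, 0, by norm_num⟩
  obtain ⟨k, b, hb4, hkb⟩ := Nat.exists_eq_pow_mul_and_not_dvd hn0 4 (by norm_num)
  obtain ⟨x, y, z, hxyz⟩ :=
    exists_rat_sq_add_sq_add_two_mul_sq_of_not_four_dvd hb4 (hn k b hkb)
  refine ⟨2 ^ k * x, 2 ^ k * y, 2 ^ k * z, ?_⟩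
  have h4 : (4 : ℚ) ^ k = (2 ^ k) ^ 2 := by rw [← pow_mul, mul_comm, pow_mul]; norm_num
  rw [hkb, Nat.cast_mul, Nat.cast_pow, Nat.cast_ofNat, h4]
  linear_combination (2 ^ k) ^ 2 * hxyz

theorem exists_rat_two_mul_sq_add_sq_add_sq_eq {a : ℤ} (ha : a ≤ 0)
    (hmod : ∀ (k : ℕ) (b : ℤ), a = 4 ^ k * b → ¬-b ≡ 2 [ZMOD 16]) :
    ∃ t x y : ℚ, 2 * t ^ 2 + x ^ 2 + y ^ 2 = -3 * a / 5 := by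
  obtain ⟨m, rfl⟩ := Int.exists_eq_neg_ofNat ha
  obtain ⟨x, y, z, hxyz⟩ := exists_rat_sq_add_sq_add_two_mul_sq (n := 15 * m) fun k b hkb hb => by
    have hcop : Nat.Coprime (4 ^ k) 15 := Nat.Coprime.pow_left k (by norm_num)
    obtain ⟨m', rfl⟩ : 4 ^ k ∣ m := hcop.dvd_of_dvd_mul_left ⟨b, hkb⟩
    have hb15 : b = 15 * m' := by
      refine Nat.eq_of_mul_eq_mul_left (by positivity : 0 < 4 ^ k) ?_
      rw [← hkb]
      ring
    refine hmod k (-m') (by push_cast; ring) ?_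
    unfold Int.ModEq
    omega
  refine ⟨z / 5, x / 5, y / 5, ?_⟩
  push_cast at hxyz ⊢
  linear_combination hxyz / 25

open IntermediateField

section FractionRing

variable {F K : Type*} [Field F] [Field K] [Algebra F K]

theorem one_lt_trdeg_of_isFractionRing_mvPolynomial [Algebra (MvPolynomial (Fin 2) F) K]
    [IsScalarTower F (MvPolynomial (Fin 2) F) K] [IsFractionRing (MvPolynomial (Fin 2) F) K] :
    1 < Algebra.trdeg F K := by
  have hle := lift_trdeg_le_of_injective (IsScalarTower.toAlgHom F (MvPolynomial (Fin 2) F) K)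
    (IsFractionRing.injective _ _)
  rw [MvPolynomial.trdeg_of_isDomain] at hle
  simp only [Cardinal.mk_fin, Nat.cast_ofNat, Cardinal.lift_ofNat,
    Cardinal.ofNat_le_lift_iff] at hle
  exact lt_of_lt_of_le (by norm_num) hle

theorem adjoin_range_algebraMap_X_eq_top (σ : Type*) [Algebra (MvPolynomial σ F) K]
    [IsScalarTower F (MvPolynomial σ F) K] [IsFractionRing (MvPolynomial σ F) K] :
    adjoin F (Set.range fun i : σ => algebraMap (MvPolynomial σ F) K (MvPolynomial.X i)) = ⊤ := by
  let g := IsScalarTower.toAlgHom F (MvPolynomial σ F) K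
  have hrange : g.range = Algebra.adjoin F (Set.range fun i => g (MvPolynomial.X i)) := by
    rw [← Function.comp_def g, Set.range_comp, ← AlgHom.map_adjoin, MvPolynomial.adjoin_range_X,
      Algebra.map_top]
  have hfield := IsFractionRing.algHom_fieldRange_eq_of_comp_eq_of_range_eq
    (f := AlgHom.id F K) (g := g) rfl hrange
  exact hfield.symm.trans (AlgHom.fieldRange_eq_top.mpr Function.surjective_id)

end FractionRing

section Algebraic

variable {F K : Type*} [Field F] [Field K] [Algebra F K]

theorem exists_mem_not_isAlgebraic_adjoin_simple {S : Set K} (htr : 1 < Algebra.trdeg F K)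
    (hS : adjoin F S = ⊤) (w : K) : ∃ z ∈ S, ¬IsAlgebraic F⟮w⟯ z := by
  by_contra! hz
  have hle : adjoin F S ≤ (algebraicClosure F⟮w⟯ K).restrictScalars F :=
    adjoin_le_iff.mpr fun z hzS => mem_algebraicClosure_iff.mpr (hz z hzS)
  rw [hS] at hle
  have halg : Algebra.IsAlgebraic F⟮w⟯ K :=
    ⟨fun z => mem_algebraicClosure_iff.mp (hle (mem_top (x := z)))⟩
  have : Algebra.IsAlgebraic (Algebra.adjoin F {w}) K := isAlgebraic_adjoin_iff_top.mp halg
  have hle_one := Algebra.IsAlgebraic.trdeg_le_cardinalMk F ({w} : Set K)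
  rw [Cardinal.mk_singleton] at hle_one
  exact hle_one.not_gt htr

theorem isAlgebraic_of_isAlgebraic_add_of_isAlgebraic_sq_add_sq (h2 : (2 : K) ≠ 0) {x y : K}
    (hadd : IsAlgebraic F (x + y)) (hsq : IsAlgebraic F (x ^ 2 + y ^ 2)) :
    IsAlgebraic F x ∧ IsAlgebraic F y := by
  have hsub : IsAlgebraic F (x - y) := by
    refine IsAlgebraic.of_pow two_pos ?_
    have heq : (x - y) ^ 2 = 2 * (x ^ 2 + y ^ 2) - (x + y) ^ 2 := by ring
    rw [heq, ← Nat.cast_ofNat]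
    exact ((isAlgebraic_natCast 2).mul hsq).sub (hadd.pow 2)
  have hx : IsAlgebraic F x := by
    have heq : x = 2⁻¹ * ((x + y) + (x - y)) := by field_simp; ring
    rw [heq, ← Nat.cast_ofNat]
    exact (isAlgebraic_natCast 2).inv.mul (hadd.add hsub)
  exact ⟨hx, by simpa using hadd.sub hx⟩

theorem aeval_ne_aeval_of_not_isAlgebraic {f g : F[X]} (hg : g.natDegree ≠ 0) {x y : K}
    (h : ¬IsAlgebraic F⟮x⟯ y) : aeval x f ≠ aeval y g := by
  intro heq
  have hg' : (g.map (algebraMap F F⟮x⟯)).natDegree ≠ 0 := by rwa [natDegree_map]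
  refine h (IsAlgebraic.of_aeval _ hg' ?_ ?_)
  · exact mem_nonZeroDivisors_of_ne_zero
      (leadingCoeff_ne_zero.mpr (ne_zero_of_natDegree_gt (Nat.pos_of_ne_zero hg')))
  · rw [aeval_map_algebraMap, ← heq, ← AdjoinSimple.algebraMap_gen F x, aeval_algebraMap_apply]
    exact isAlgebraic_algebraMap _

theorem nonTrivialPoint_of_not_isAlgebraic [CharZero F] {f : ℤ[X]} (hf : f.natDegree ≠ 0)
    {p q r s : K} (hpq : ¬IsAlgebraic F⟮p⟯ q)
    (h : ∀ w ∈ ({p, q} : Set K), ∀ z ∈ ({r, s} : Set K), ¬IsAlgebraic F⟮w⟯ z) :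
    NonTrivialPoint f p q r s := by
  let fF := f.map (algebraMap ℤ F)
  have hfF : fF.natDegree ≠ 0 := by
    rwa [natDegree_map_eq_of_injective (RingHom.injective_int (algebraMap ℤ F))]
  have hval (w : K) : aeval w f = aeval w fF := (aeval_map_algebraMap F w f).symm
  have hdisj : Disjoint ((aeval · f) '' ({p, q} : Set K)) ((aeval · f) '' {r, s}) := by
    rw [Set.disjoint_left]
    rintro _ ⟨w, hw, rfl⟩ ⟨z, hz, hzw⟩
    simp only [hval] at hzw
    exact aeval_ne_aeval_of_not_isAlgebraic hfF (h w hw z hz) hzw.symm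
  refine ⟨hdisj.of_image, ?_, fun hsum => ?_⟩
  · simpa only [Set.image_pair] using hdisj
  · refine aeval_ne_aeval_of_not_isAlgebraic (f := -fF) hfF hpq ?_
    rw [map_neg, ← hval, ← hval]
    exact neg_eq_of_add_eq_zero_right hsum

end Algebraic

/-- The quadric surface `p + q = r + s`, `p ^ 2 + q ^ 2 + r ^ 2 + s ^ 2 = -6 a / 5` in affine
four-space. It is contained in the hypersurface `f(p) + f(q) = f(r) + f(s)` for
`f = X ^ 5 + a X ^ 3 + c X`, whatever `c` is. -/
def OnQuadric {K : Type*} [Field K] (a : ℤ) (p q r s : K) : Prop :=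
  p + q = r + s ∧ 5 * (p ^ 2 + q ^ 2 + r ^ 2 + s ^ 2) = -6 * a

theorem aeval_oddQuintic {K : Type*} [Field K] (a c : ℤ) (w : K) :
    aeval w (oddQuintic a c) = w ^ 5 + a * w ^ 3 + c * w := by
  simp [oddQuintic]

theorem natDegree_oddQuintic (a c : ℤ) : (oddQuintic a c).natDegree = 5 := by
  unfold oddQuintic
  compute_degree!

namespace OnQuadric

section Field

variable {K : Type*} [Field K] {a : ℤ} {p q r s : K}

theorem swap_left (h : OnQuadric a p q r s) : OnQuadric a q p r s :=
  ⟨by linear_combination h.1, by linear_combination h.2⟩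

theorem swap_right (h : OnQuadric a p q r s) : OnQuadric a p q s r :=
  ⟨by linear_combination h.1, by linear_combination h.2⟩

theorem neg_swap_middle (h : OnQuadric a p q r s) : OnQuadric a p (-r) (-q) s :=
  ⟨by linear_combination h.1, by linear_combination h.2⟩

theorem onHypersurface (h2 : (2 : K) ≠ 0) (h : OnQuadric a p q r s) (c : ℤ) :
    OnHypersurface (oddQuintic a c) p q r s := by
  obtain rfl : s = p + q - r := by linear_combination -h.1
  have hq := h.2
  unfold OnHypersurface
  simp only [aeval_oddQuintic]
  refine mul_left_cancel₀ h2 ?_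
  linear_combination (-(p + q) * (p * q - r * (p + q - r))) * hq

end Field

section Algebraic

variable {F K : Type*} [Field F] [Field K] [Algebra F K] [CharZero K] {a : ℤ} {p q r s : K}

theorem isAlgebraic_right (h : OnQuadric a p q r s) (hp : IsAlgebraic F p)
    (hq : IsAlgebraic F q) : IsAlgebraic F r ∧ IsAlgebraic F s := by
  apply isAlgebraic_of_isAlgebraic_add_of_isAlgebraic_sq_add_sq two_ne_zero
  · exact h.1 ▸ hp.add hq
  · have hsq : r ^ 2 + s ^ 2 = (-6 * a : ℤ) * ((5 : ℕ) : K)⁻¹ - (p ^ 2 + q ^ 2) := by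
      push_cast
      field_simp
      linear_combination h.2
    rw [hsq]
    exact ((isAlgebraic_intCast _).mul (isAlgebraic_natCast 5).inv).sub ((hp.pow 2).add (hq.pow 2))

theorem isAlgebraic_of_first_third (h : OnQuadric a p q r s) (hp : IsAlgebraic F p)
    (hr : IsAlgebraic F r) : ∀ x ∈ ({p, q, r, s} : Set K), IsAlgebraic F x := by
  obtain ⟨hq, hs⟩ := h.neg_swap_middle.isAlgebraic_right hp hr.neg
  rintro x (rfl | rfl | rfl | rfl)
  exacts [hp, by simpa using hq.neg, hr, hs]

theorem isAlgebraic_of_mem_pair (h : OnQuadric a p q r s) {w z : K}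
    (hw : w ∈ ({p, q} : Set K)) (hz : z ∈ ({r, s} : Set K)) (hwF : IsAlgebraic F w)
    (hzF : IsAlgebraic F z) : ∀ x ∈ ({p, q, r, s} : Set K), IsAlgebraic F x := by
  rcases hw with rfl | rfl <;> rcases hz with rfl | rfl
  · exact h.isAlgebraic_of_first_third hwF hzF
  · simpa only [Set.pair_comm] using h.swap_right.isAlgebraic_of_first_third hwF hzF
  · simpa only [Set.insert_comm] using h.swap_left.isAlgebraic_of_first_third hwF hzF
  · simpa only [Set.insert_comm, Set.pair_comm] using
      h.swap_left.swap_right.isAlgebraic_of_first_third hwF hzF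

theorem nonTrivialPoint (h : OnQuadric a p q r s) (htr : 1 < Algebra.trdeg F K)
    (hgen : adjoin F {p, q, r, s} = ⊤) (c : ℤ) : NonTrivialPoint (oddQuintic a c) p q r s := by
  have : CharZero F := (algebraMap F K).charZero
  have hself (w : K) : IsAlgebraic F⟮w⟯ w := isAlgebraic_algebraMap (AdjoinSimple.gen F w)
  have hexists (w : K) := exists_mem_not_isAlgebraic_adjoin_simple htr hgen w
  refine nonTrivialPoint_of_not_isAlgebraic (F := F)
    (by rw [natDegree_oddQuintic]; norm_num) (fun hq => ?_) (fun w hw z hz hwz => ?_)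
  · obtain ⟨x, hx, hx_not⟩ := hexists p
    obtain ⟨hr, hs⟩ := h.isAlgebraic_right (hself p) hq
    rcases hx with rfl | rfl | rfl | rfl
    exacts [hx_not (hself _), hx_not hq, hx_not hr, hx_not hs]
  · obtain ⟨x, hx, hx_not⟩ := hexists w
    exact hx_not (h.isAlgebraic_of_mem_pair hw hz (hself w) hwz x hx)

end Algebraic

theorem isTwoParametricSolution {a : ℤ} {p q r s : TwoParamField} (h : OnQuadric a p q r s)
    (hgen : adjoin ℚ {p, q, r, s} = ⊤) (c : ℤ) :
    IsTwoParametricSolution (oddQuintic a c) p q r s where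
  onHypersurface := h.onHypersurface two_ne_zero c
  nonTrivial := h.nonTrivialPoint one_lt_trdeg_of_isFractionRing_mvPolynomial hgen c
  birational := hgen

theorem of_two_mul_sq_add_sq_add_sq_eq {K : Type*} [Field K] {a : ℤ} {t x y : K}
    (h : 5 * (2 * t ^ 2 + x ^ 2 + y ^ 2) = -3 * a) :
    OnQuadric a (t + x) (t - x) (t + y) (t - y) :=
  ⟨by ring, by linear_combination 2 * h⟩

end OnQuadric

theorem adjoin_add_sub_eq_top {F K : Type*} [Field F] [Field K] [Algebra F K]
    (h2 : (2 : K) ≠ 0) {t x y : K} (h : adjoin F {t, x, y} = ⊤) :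
    adjoin F {t + x, t - x, t + y, t - y} = ⊤ := by
  set E := adjoin F {t + x, t - x, t + y, t - y} with hE
  have hmem : ({t + x, t - x, t + y, t - y} : Set K) ⊆ E := subset_adjoin F _
  simp only [Set.insert_subset_iff, Set.singleton_subset_iff, SetLike.mem_coe] at hmem
  obtain ⟨htx, htx', hty, -⟩ := hmem
  have ht : t ∈ E := by
    have heq : t = (t + x + (t - x)) / 2 := by field_simp; ring
    rw [heq]
    exact div_mem (add_mem htx htx') (ofNat_mem E 2)
  rw [eq_top_iff, ← h, adjoin_le_iff]
  rintro w (rfl | rfl | rfl)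
  exacts [ht, by simpa using sub_mem htx ht, by simpa using sub_mem hty ht]

theorem eq_zero_of_C_mul_X_pow_add_C_mul_X_pow_add_C_eq_zero {R : Type*} [CommSemiring R]
    {α β γ : R} {k : ℕ} (hk : k ≠ 0)
    (h : MvPolynomial.C α * MvPolynomial.X 0 ^ k + MvPolynomial.C β * MvPolynomial.X 1 ^ k +
      MvPolynomial.C γ = (0 : MvPolynomial (Fin 2) R)) : α = 0 ∧ β = 0 ∧ γ = 0 := by
  have heval (w : Fin 2 → R) : α * w 0 ^ k + β * w 1 ^ k + γ = 0 := by
    simpa using congrArg (MvPolynomial.eval w) h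
  have hγ : γ = 0 := by simpa [hk] using heval ![0, 0]
  exact ⟨by simpa [hk, hγ] using heval ![1, 0], by simpa [hk, hγ] using heval ![0, 1], hγ⟩

section Stereographic

variable {F K : Type*} [Field F] [Field K] [Algebra F K]

theorem adjoin_add_mul_eq_top {u v l : K} (hl : l ≠ 0) (h : adjoin F {u, v} = ⊤)
    (t₀ x₀ y₀ : F) :
    adjoin F {algebraMap F K t₀ + l * u, algebraMap F K x₀ + l * v, algebraMap F K y₀ + l} = ⊤ := by
  set E := adjoin F
    {algebraMap F K t₀ + l * u, algebraMap F K x₀ + l * v, algebraMap F K y₀ + l} with hE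
  have hmem : ({algebraMap F K t₀ + l * u, algebraMap F K x₀ + l * v, algebraMap F K y₀ + l} :
    Set K) ⊆ E := subset_adjoin F _
  simp only [Set.insert_subset_iff, Set.singleton_subset_iff, SetLike.mem_coe,
    add_mem_cancel_left (E.algebraMap_mem _)] at hmem
  obtain ⟨hlu, hlv, hlE⟩ := hmem
  rw [eq_top_iff, ← h, adjoin_le_iff]
  rintro w (rfl | rfl)
  exacts [by simpa [hl] using div_mem hlu hlE, by simpa [hl] using div_mem hlv hlE]

variable [Algebra (MvPolynomial (Fin 2) F) K] [IsScalarTower F (MvPolynomial (Fin 2) F) K]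
  [IsFractionRing (MvPolynomial (Fin 2) F) K]

variable (F K) in
theorem exists_parameters_of_isFractionRing_mvPolynomial :
    ∃ u v : K, adjoin F {u, v} = ⊤ ∧ ∀ (k : ℕ) (α β γ : F), k ≠ 0 → ¬(α = 0 ∧ β = 0 ∧ γ = 0) →
      algebraMap F K α * u ^ k + algebraMap F K β * v ^ k + algebraMap F K γ ≠ 0 := by
  let ι := algebraMap (MvPolynomial (Fin 2) F) K
  refine ⟨ι (MvPolynomial.X 0), ι (MvPolynomial.X 1), ?_, fun k α β γ hk hne hzero => ?_⟩
  · rw [← adjoin_range_algebraMap_X_eq_top (F := F) (K := K) (Fin 2)]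
    congr 1
    ext
    simp [Fin.exists_fin_two, ι, eq_comm]
  · refine hne (eq_zero_of_C_mul_X_pow_add_C_mul_X_pow_add_C_eq_zero hk
      (IsFractionRing.injective (MvPolynomial (Fin 2) F) K ?_))
    simpa [ι, IsScalarTower.algebraMap_apply F (MvPolynomial (Fin 2) F) K] using hzero

theorem exists_generic_point_of_diagonal_quadric (h2 : (2 : F) ≠ 0) {A B C t₀ x₀ y₀ : F}
    (h₀ : A * t₀ ^ 2 + B * x₀ ^ 2 + C * y₀ ^ 2 ≠ 0) :
    ∃ t x y : K, algebraMap F K A * t ^ 2 + algebraMap F K B * x ^ 2 + algebraMap F K C * y ^ 2 =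
      algebraMap F K (A * t₀ ^ 2 + B * x₀ ^ 2 + C * y₀ ^ 2) ∧ adjoin F {t, x, y} = ⊤ := by
  let φ := algebraMap F K
  obtain ⟨u, v, hgen, hne⟩ := exists_parameters_of_isFractionRing_mvPolynomial F K
  have hden : φ A * u ^ 2 + φ B * v ^ 2 + φ C ≠ 0 :=
    hne 2 A B C two_ne_zero (by rintro ⟨rfl, rfl, rfl⟩; simp at h₀)
  have hnum : φ (A * t₀) * u ^ 1 + φ (B * x₀) * v ^ 1 + φ (C * y₀) ≠ 0 :=
    hne 1 _ _ _ one_ne_zero fun ⟨ht, hx, hy⟩ =>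
      h₀ (by linear_combination t₀ * ht + x₀ * hx + y₀ * hy)
  -- The second intersection of the quadric with the line `(t₀, x₀, y₀) + l (u, v, 1)`.
  let l := -φ 2 * (φ (A * t₀) * u ^ 1 + φ (B * x₀) * v ^ 1 + φ (C * y₀)) /
    (φ A * u ^ 2 + φ B * v ^ 2 + φ C)
  have hl : l ≠ 0 := div_ne_zero (mul_ne_zero (by simpa [φ] using h2) hnum) hden
  have hlden : l * (φ A * u ^ 2 + φ B * v ^ 2 + φ C) =
      -φ 2 * (φ (A * t₀) * u ^ 1 + φ (B * x₀) * v ^ 1 + φ (C * y₀)) := div_mul_cancel₀ _ hden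
  refine ⟨φ t₀ + l * u, φ x₀ + l * v, φ y₀ + l, ?_, adjoin_add_mul_eq_top hl hgen t₀ x₀ y₀⟩
  simp only [map_add, map_mul, map_pow, map_ofNat, φ] at hlden ⊢
  linear_combination l * hlden

end Stereographic

theorem OnQuadric.exists_adjoin_eq_top {a : ℤ} (ha : a ≠ 0) {t₀ x₀ y₀ : ℚ}
    (h₀ : 2 * t₀ ^ 2 + x₀ ^ 2 + y₀ ^ 2 = -3 * a / 5) :
    ∃ p q r s : TwoParamField, OnQuadric a p q r s ∧ adjoin ℚ {p, q, r, s} = ⊤ := by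
  have hne : 2 * t₀ ^ 2 + 1 * x₀ ^ 2 + 1 * y₀ ^ 2 ≠ 0 := by
    rw [one_mul, one_mul, h₀]
    positivity
  obtain ⟨t, x, y, htxy, hgen⟩ :=
    exists_generic_point_of_diagonal_quadric (K := TwoParamField) two_ne_zero hne
  have hquadric : 5 * (2 * t ^ 2 + x ^ 2 + y ^ 2) = (-3 * a : TwoParamField) := by
    simp only [one_mul, h₀, map_ofNat, map_one, map_div₀, map_mul, map_neg, map_intCast] at htxy
    rw [htxy, mul_div_cancel₀ _ (by norm_num)]
  exact ⟨_, _, _, _, of_two_mul_sq_add_sq_add_sq_eq hquadric,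
    adjoin_add_sub_eq_top two_ne_zero hgen⟩

theorem theorem2 (a c : ℤ) (ha : a < 0)
    (hmod : ∀ (k : ℕ) (b : ℤ), a = 4 ^ k * b →
      ¬ -b ≡ 2 [ZMOD 48] ∧ ¬ -b ≡ 18 [ZMOD 48] ∧ ¬ -b ≡ 34 [ZMOD 48]) :
    ∃ p q r s : TwoParamField, IsTwoParametricSolution (oddQuintic a c) p q r s := by
  have hmod16 (k : ℕ) (b : ℤ) (hab : a = 4 ^ k * b) : ¬-b ≡ 2 [ZMOD 16] := by
    have := hmod k b hab
    unfold Int.ModEq at this ⊢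
    omega
  obtain ⟨t₀, x₀, y₀, h₀⟩ := exists_rat_two_mul_sq_add_sq_add_sq_eq ha.le hmod16
  obtain ⟨p, q, r, s, hquadric, hgen⟩ := OnQuadric.exists_adjoin_eq_top ha.ne h₀
  exact ⟨p, q, r, s, hquadric.isTwoParametricSolution hgen c⟩
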